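/- Let $n\ge 2$, identify $\mathbb C^n$ with $\mathbb R^{2n}$ via $z=x+iy$, and let $\sigma$ be the surface measure on the unit sphere $S^{2n-1}\subset\mathbb C^n$. Let $X(S^{2n-1})$ be the space of finite complex Borel measures $\mu$ on $\mathbb C^n$ that are supported on $S^{2n-1}$ and absolutely continuous with respect to $\sigma$; thus $d\mu=f\,d\sigma$ with $f\in L^1(S^{2n-1})$. The symplectic Fourier transform of $\mu$ is $$\mathcal F_S\mu(z)=\int_{S^{2n-1}}e^{-\frac i2\operatorname{Im}(z\cdot\bar\zeta)}f(\zeta)\,d\sigma(\zeta),\qquad z\in\mathbb C^n,\quad z\cdot\bar\zeta=\sum_{j=1}^n z_j\bar\zeta_j .$$ For $\Lambda\subseteq\mathbb C^n$, the pair $(S^{2n-1},\Lambda)$ is called a Heisenberg uniqueness pair for the symplectic Fourier transform if the only $\mu\in X(S^{2n-1})$ with $\mathcal F_S\mu(z)=0$ for all $z\in\Lambda$ is $\mu=0$. A set $\mathcal C\subseteq\mathbb C^n$ is a complex (respectively, real) cone if $\lambda\mathcal C\subseteq\mathcal C$ for all $\lambda\in\mathbb C$ (respectively, $\lambda\in\mathbb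 R$). A cone is non-harmonic if it is not contained in the zero set of any nonzero homogeneous polynomial $P$ in the real coordinates $(x,y)$, with complex coefficients, such that $\sum_{j=1}^n\left(\partial_{x_j}^2+\partial_{y_j}^2\right)P=0$. (i) For every complex cone $\mathcal C\subseteq\mathbb C^n$, $(S^{2n-1},\mathcal C)$ is a Heisenberg uniqueness pair for the symplectic Fourier transform if and only if $\mathcal C$ is non-harmonic. (ii) The same equivalence holds for every real cone $\mathcal C\subseteq\mathbb C^n=\mathbb R^{2n}$. -/

import Mathlib

open MeasureTheory

noncomputable section

namespace SymplecticHUP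

/-- The space `ℂⁿ` with its Hermitian norm; as a real space it is `ℝ²ⁿ`. -/
abbrev Cn (n : ℕ) : Type := EuclideanSpace ℂ (Fin n)

/-- Surface measure on the unit sphere `S²ⁿ⁻¹`, as a Borel measure on `ℂⁿ` carried by the sphere. -/
def surfaceMeasure (n : ℕ) : Measure (Cn n) :=
  ((volume : Measure (Cn n)).toSphere).map Subtype.val

/-- `X(S²ⁿ⁻¹)`: the finite complex Borel measures on `ℂⁿ` which are supported on the unit sphere
and absolutely continuous with respect to surface measure. -/
def sphereMeasures (n : ℕ) : Set (ComplexMeasure (Cn n)) :=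
  {μ | (∀ A : Set (Cn n), Disjoint A (Metric.sphere 0 1) → μ A = 0) ∧
    μ ≪ᵥ (surfaceMeasure n).toENNRealVectorMeasure}

/-- The symplectic Fourier transform
`z ↦ ∫ exp (-(i/2) Im (z · conj ζ)) f(ζ) dσ(ζ)`, where `f = dμ/dσ` is the Radon–Nikodym density of
`μ` with respect to surface measure. -/
def symplecticFourier {n : ℕ} (μ : ComplexMeasure (Cn n)) (z : Cn n) : ℂ :=
  ∫ ζ, Complex.exp (-(Complex.I / 2) *
      ((∑ j, z j * (starRingEnd ℂ) (ζ j)).im : ℂ)) * μ.rnDeriv (surfaceMeasure n) ζ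
    ∂(surfaceMeasure n)

/-- `(S²ⁿ⁻¹, Λ)` is a Heisenberg uniqueness pair for the symplectic Fourier transform. -/
def IsHeisenbergUniquenessPair {n : ℕ} (Λ : Set (Cn n)) : Prop :=
  ∀ μ ∈ sphereMeasures n, (∀ z ∈ Λ, symplecticFourier μ z = 0) → μ = 0

def IsComplexCone {n : ℕ} (C : Set (Cn n)) : Prop :=
  ∀ c : ℂ, ∀ z ∈ C, c • z ∈ C

/-- A real cone in `ℝ²ⁿ = ℂⁿ`. -/
def IsRealCone {n : ℕ} (C : Set (Cn n)) : Prop :=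
  ∀ c : ℝ, ∀ z ∈ C, c • z ∈ C

/-- The real coordinates `(x₁, …, xₙ, y₁, …, yₙ)` of `z = x + iy`, as complex numbers. -/
def realCoords {n : ℕ} (z : Cn n) : Fin n ⊕ Fin n → ℂ :=
  Sum.elim (fun j => ((z j).re : ℂ)) (fun j => ((z j).im : ℂ))

/-- A polynomial in the real coordinates `x, y`, with complex coefficients, is harmonic if
`∑ⱼ (∂²/∂xⱼ² + ∂²/∂yⱼ²) P = 0`. -/
def IsHarmonicPoly {n : ℕ} (P : MvPolynomial (Fin n ⊕ Fin n) ℂ) : Prop :=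
  ∑ i, MvPolynomial.pderiv i (MvPolynomial.pderiv i P) = 0

/-- `C` is non-harmonic: it is not contained in the zero set of any nonzero homogeneous harmonic
polynomial on `ℂⁿ = ℝ²ⁿ`. -/
def IsNonHarmonic {n : ℕ} (C : Set (Cn n)) : Prop :=
  ¬ ∃ (l : ℕ) (P : MvPolynomial (Fin n ⊕ Fin n) ℂ), P ≠ 0 ∧ P.IsHomogeneous l ∧
    IsHarmonicPoly P ∧ ∀ z ∈ C, MvPolynomial.eval (realCoords z) P = 0

end SymplecticHUP

end

/-! Since `Im (z · conj ζ)` is the real inner product of `z` and `iζ`, the exponential series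
(`hasSum_symplecticFourier`) expresses the transform at `z` through the moments `T (linForm w ^ k)`,
where `w = realCoords z` and `T` integrates polynomials in `coords ζ` against the density.

If a harmonic homogeneous `P ≠ 0` vanishes on `C`, the density `P` is a counterexample to
uniqueness: its moments along every zero `w` of `P` vanish. In polar coordinates sphere integrals of
homogeneous polynomials are multiples of Gaussian ones (`exists_gaussianIntegral_eq`), and there
Stein's identity gives the claim by induction (`map_linForm_pow_mul_eq_zero`).

Conversely, if the transform vanishes on a real cone, its expansion along each real line of the cone
makes every moment vanish there. The polynomials `w ↦ T (linForm w ^ k) / k!` satisfy `Δ M (k + 2) =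
M k`, because `|x|² = 1` on the sphere; so the first nonzero one is harmonic
(`exists_harmonic_momentPoly`) and vanishes on `C`. Non-harmonicity therefore forces `T = 0`, hence
a transform that vanishes everywhere, hence `μ = 0`. A complex cone is a real cone, so (i) follows
from (ii). -/

noncomputable section

/-! ### Harmonic polynomials and functionals satisfying Stein's identity -/

namespace MvPolynomial

variable {σ : Type*}

lemma pderiv_comm (i j : σ) (P : MvPolynomial σ ℂ) :
    pderiv i (pderiv j P) = pderiv j (pderiv i P) := by
  classical
  ext m
  simp only [coeff_pderiv]
  rw [add_right_comm]
  by_cases h : i = j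
  · subst h; rfl
  · simp [h, Ne.symm h]; ring

variable [Fintype σ]

/-- The linear form `∑ i, w i * X i`. -/
def linForm (w : σ → ℂ) : MvPolynomial σ ℂ := ∑ i, C (w i) * X i

lemma eval_linForm (w v : σ → ℂ) : eval v (linForm w) = ∑ i, w i * v i := by
  simp [linForm]

lemma isHomogeneous_linForm (w : σ → ℂ) : (linForm w).IsHomogeneous 1 :=
  IsHomogeneous.sum _ _ _ fun i _ => by
    simpa using (isHomogeneous_C σ (w i)).mul (isHomogeneous_X ℂ i)

lemma pderiv_linForm (w : σ → ℂ) (i : σ) : pderiv i (linForm w) = C (w i) := by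
  classical
  simp [linForm, map_sum, pderiv_X, Pi.single_apply]

/-- The Laplacian of a polynomial. -/
def laplacian (P : MvPolynomial σ ℂ) : MvPolynomial σ ℂ := ∑ i, pderiv i (pderiv i P)

/-- The derivative of `P` in the direction `w`. -/
def dirDeriv (w : σ → ℂ) (P : MvPolynomial σ ℂ) : MvPolynomial σ ℂ := ∑ i, C (w i) * pderiv i P

lemma laplacian_dirDeriv (w : σ → ℂ) {P : MvPolynomial σ ℂ} (hP : laplacian P = 0) :
    laplacian (dirDeriv w P) = 0 := by
  have : laplacian (dirDeriv w P) = dirDeriv w (laplacian P) := by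
    simp only [laplacian, dirDeriv, map_sum, pderiv_C_mul, Finset.mul_sum]
    rw [Finset.sum_comm]
    refine Finset.sum_congr rfl fun i _ => Finset.sum_congr rfl fun j _ => ?_
    rw [pderiv_comm j i, pderiv_comm j i]
  rw [this, hP]
  simp [dirDeriv]

lemma IsHomogeneous.dirDeriv {P : MvPolynomial σ ℂ} {l : ℕ} (hP : P.IsHomogeneous l)
    (w : σ → ℂ) : (dirDeriv w P).IsHomogeneous (l - 1) :=
  IsHomogeneous.sum _ _ _ fun i _ => by
    simpa using (isHomogeneous_C σ (w i)).mul hP.pderiv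

lemma IsHomogeneous.eval_dirDeriv_self {P : MvPolynomial σ ℂ} {l : ℕ} (hP : P.IsHomogeneous l)
    (w : σ → ℂ) : eval w (MvPolynomial.dirDeriv w P) = l * eval w P := by
  have := congrArg (eval w) hP.sum_X_mul_pderiv
  simpa [MvPolynomial.dirDeriv, map_sum] using this

/-- A functional satisfying Stein's identity, such as the Gaussian integral, vanishes on the
products of powers of the linear form `w` with harmonic polynomials vanishing at `w`. -/
lemma map_linForm_pow_mul_eq_zero (T : MvPolynomial σ ℂ →ₗ[ℂ] ℂ)
    (hT : ∀ i p, T (X i * p) = T (pderiv i p)) (w : σ → ℂ) (k : ℕ) :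
    ∀ (l : ℕ) (P : MvPolynomial σ ℂ), P.IsHomogeneous l → laplacian P = 0 → eval w P = 0 →
      T (linForm w ^ k * P) = 0 := by
  induction k using Nat.strong_induction_on with
  | _ k ih =>
    intro l P hl hP hw
    rcases k with _ | k
    · rcases Nat.eq_zero_or_pos l with rfl | hpos
      · rw [← totalDegree_zero_iff_isHomogeneous, totalDegree_eq_zero_iff_eq_C] at hl
        rw [hl, eval_C] at hw
        rw [hl, hw]
        simp
      -- Euler's identity followed by Stein's turns `l * T P` into `T (ΔP) = 0`.
      · have h := congrArg T hl.sum_X_mul_pderiv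
        rw [map_sum] at h
        simp only [hT] at h
        rw [← map_sum, ← laplacian, hP, map_zero, map_nsmul] at h
        simpa [hpos.ne'] using h.symm
    -- Stein's identity trades one factor `linForm w` for a derivative in the direction `w`.
    · have key : T (linForm w ^ (k + 1) * P) =
          T (dirDeriv w (linForm w ^ k * P)) := by
        have : linForm w ^ (k + 1) * P = ∑ i, w i • (X i * (linForm w ^ k * P)) := by
          rw [pow_succ', mul_assoc, linForm, Finset.sum_mul]
          simp [smul_eq_C_mul, mul_assoc]
        rw [this, map_sum, dirDeriv, map_sum]
        refine Finset.sum_congr rfl fun i _ => ?_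
        rw [map_smul, hT, ← map_smul, smul_eq_C_mul]
      -- Both terms have lower powers of `linForm w`, and `dirDeriv w P` is again harmonic and, by
      -- Euler, zero at `w`. For `k = 0` the truncated `k - 1` is harmless, as its coefficient is
      -- zero.
      have expand : dirDeriv w (linForm w ^ k * P) =
          ((∑ i, w i * w i) * k) • (linForm w ^ (k - 1) * P) + linForm w ^ k * dirDeriv w P := by
        simp only [dirDeriv, Finset.mul_sum, pderiv_mul, pderiv_pow, pderiv_linForm,
          mul_add, Finset.sum_add_distrib]
        congr 1
        · simp only [smul_eq_C_mul, map_mul, map_sum, Finset.sum_mul, map_natCast]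
          exact Finset.sum_congr rfl fun i _ => by ring
        · exact Finset.sum_congr rfl fun i _ => by ring
      rw [key, expand, map_add, map_smul, ih (k - 1) (by omega) l P hl hP hw,
        ih k (by omega) (l - 1) _ (hl.dirDeriv w) (laplacian_dirDeriv w hP)
          (by rw [hl.eval_dirDeriv_self, hw, mul_zero])]
      simp

/-! ### Moment polynomials -/

/-- The degree `k` part of the generating polynomial of the moments of `T`. -/
def momentPoly (T : MvPolynomial σ ℂ →ₗ[ℂ] ℂ) (k : ℕ) : MvPolynomial σ ℂ :=
  letI := Classical.decEq σ
  ∑ m ∈ (Finset.univ : Finset σ).finsuppAntidiag k,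
    monomial m (T (monomial m 1) / ∏ i, ((m i).factorial : ℂ))

variable (T : MvPolynomial σ ℂ →ₗ[ℂ] ℂ)

lemma coeff_momentPoly (k : ℕ) (m : σ →₀ ℕ) :
    coeff m (momentPoly T k) =
      if ∑ i, m i = k then T (monomial m 1) / ∏ i, ((m i).factorial : ℂ) else 0 := by
  classical
  simp [momentPoly, coeff_sum, coeff_monomial, Finset.mem_finsuppAntidiag]

lemma isHomogeneous_momentPoly (k : ℕ) : (momentPoly T k).IsHomogeneous k := by
  classical
  refine IsHomogeneous.sum _ _ _ fun m hm => isHomogeneous_monomial _ ?_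
  rw [Finset.mem_finsuppAntidiag] at hm
  rw [Finsupp.degree_eq_sum, hm.1]

lemma eval_momentPoly (k : ℕ) (w : σ → ℂ) :
    k.factorial * eval w (momentPoly T k) = T (linForm w ^ k) := by
  classical
  -- The multinomial theorem; its denominators are those in `momentPoly`.
  have h : linForm w ^ k = ∑ m ∈ (Finset.univ : Finset σ).finsuppAntidiag k,
      (((Finset.univ.sum m).factorial / ∏ i, ((m i).factorial : ℂ)) * ∏ i, w i ^ m i) •
        (monomial m (1 : ℂ)) := by
    ext m
    have : linForm w = ∑ i, w i • X i := by simp [linForm, smul_eq_C_mul]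
    rw [this, coeff_linearCombination_X_pow_of_fintype]
    simp only [coeff_sum, coeff_smul, coeff_monomial, smul_eq_mul, mul_ite, mul_one, mul_zero,
      Finset.sum_ite_eq', Finset.mem_finsuppAntidiag, Finset.subset_univ, and_true]
    rw [Finsupp.sum_fintype _ _ (by simp), Finsupp.prod_fintype _ _ (by simp)]
    refine if_congr Iff.rfl ?_ rfl
    congr 1
    rw [← Finsupp.multinomial_of_support_subset (Finset.subset_univ _), eq_div_iff
      (Finset.prod_ne_zero_iff.2 fun i _ => Nat.cast_ne_zero.2 (Nat.factorial_ne_zero _))]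
    rw [mul_comm]
    exact_mod_cast Nat.multinomial_spec Finset.univ m
  rw [h, map_sum, momentPoly, map_sum, Finset.mul_sum]
  refine Finset.sum_congr rfl fun m hm => ?_
  rw [Finset.mem_finsuppAntidiag] at hm
  rw [map_smul, eval_monomial, hm.1, Finsupp.prod_fintype _ _ (by simp), smul_eq_mul]
  ring

/-- Formally `Δ_w exp (w · x) = |x|² exp (w · x)`, and `T` does not see the factor `|x|²`. On
coefficients, the factors from differentiating twice cancel against the factorials. -/
lemma laplacian_momentPoly (hT : ∀ p, T ((∑ i, X i ^ 2) * p) = T p) (k : ℕ) :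
    laplacian (momentPoly T (k + 2)) = momentPoly T k := by
  classical
  ext m
  rw [laplacian, coeff_sum, coeff_momentPoly]
  have hdeg (i : σ) : ∑ j, (m + Finsupp.single i 1 + Finsupp.single i 1 : σ →₀ ℕ) j = ∑ j, m j + 2 := by
    simp [Finset.sum_add_distrib, Finsupp.single_apply]
  have hfac (i : σ) :
      ∏ j, (((m + Finsupp.single i 1 + Finsupp.single i 1 : σ →₀ ℕ) j).factorial : ℂ) =
        (m i + 1 + 1) * (m i + 1) * ∏ j, ((m j).factorial : ℂ) := by
    rw [← Finset.mul_prod_erase _ _ (Finset.mem_univ i),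
      ← Finset.mul_prod_erase _ (fun j => ((m j).factorial : ℂ)) (Finset.mem_univ i), ← mul_assoc]
    congr 1
    · simp [Nat.factorial_succ]; ring
    · refine Finset.prod_congr rfl fun j hj => ?_
      rw [Finset.mem_erase] at hj
      simp [hj.1.symm]
  simp only [coeff_pderiv, coeff_momentPoly, hdeg, Nat.add_right_cancel_iff]
  split_ifs with h
  · have hne : ∏ j, ((m j).factorial : ℂ) ≠ 0 :=
      Finset.prod_ne_zero_iff.2 fun i _ => Nat.cast_ne_zero.2 (Nat.factorial_ne_zero _)
    rw [← hT (monomial m 1), Finset.sum_mul, map_sum, Finset.sum_div]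
    refine Finset.sum_congr rfl fun i _ => ?_
    have h1 : (X i ^ 2 * monomial m 1 : MvPolynomial σ ℂ) =
        monomial (m + Finsupp.single i 1 + Finsupp.single i 1) 1 := by
      rw [pow_two, X, monomial_mul, monomial_mul, add_comm, ← add_assoc]
      simp
    rw [hfac, h1]
    have h2 : (m i : ℂ) + 1 ≠ 0 := Nat.cast_add_one_ne_zero _
    have h3 : (m i : ℂ) + 1 + 1 ≠ 0 := by
      simpa using Nat.cast_add_one_ne_zero (R := ℂ) (m i + 1)
    simp
    field_simp
  · simp

lemma map_eq_zero_of_momentPoly_eq_zero (h : ∀ k, momentPoly T k = 0) : T = 0 := by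
  refine linearMap_ext fun m => LinearMap.ext_ring ?_
  have := congrArg (coeff m) (h (∑ i, m i))
  rw [coeff_momentPoly, if_pos rfl, coeff_zero, div_eq_zero_iff] at this
  simpa [Finset.prod_eq_zero_iff, Nat.factorial_ne_zero] using this

/-- A nonzero functional on polynomials restricted to the sphere has a nonzero harmonic
homogeneous generating polynomial of moments. -/
lemma exists_harmonic_momentPoly (hT : ∀ p, T ((∑ i, X i ^ 2) * p) = T p) (h0 : T ≠ 0) :
    ∃ k, momentPoly T k ≠ 0 ∧ laplacian (momentPoly T k) = 0 := by
  classical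
  have hex : ∃ k, momentPoly T k ≠ 0 := by
    by_contra! h
    exact h0 (map_eq_zero_of_momentPoly_eq_zero T h)
  -- The least degree works: in degrees 0 and 1 the Laplacian is trivially zero, and above that it
  -- is the moment polynomial two degrees lower, zero by minimality.
  refine ⟨Nat.find hex, Nat.find_spec hex, ?_⟩
  generalize hk : Nat.find hex = k
  rcases k with _ | _ | k
  · ext m
    simp only [laplacian, coeff_sum, coeff_pderiv, coeff_momentPoly, coeff_zero]
    refine Finset.sum_eq_zero fun i _ => ?_
    rw [if_neg]
    · simp
    · simp [Finset.sum_add_distrib, Finsupp.single_apply]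
  · ext m
    simp only [laplacian, coeff_sum, coeff_pderiv, coeff_momentPoly, coeff_zero]
    refine Finset.sum_eq_zero fun i _ => ?_
    rw [if_neg]
    · simp
    · simp [Finset.sum_add_distrib, Finsupp.single_apply]
  · rw [laplacian_momentPoly T hT]
    have := Nat.find_min hex (m := k) (by omega)
    simpa using this

end MvPolynomial

end

noncomputable section

namespace SymplecticHUP

open MvPolynomial

/-! ### Symplectic coordinates -/

section Coords

variable {n : ℕ}

/-- The real coordinates of `i ζ`, so that `Im (z · conj ζ) = ∑ i, realCoords z i * coords ζ i`. -/
def coords (ζ : Cn n) : Fin n ⊕ Fin n → ℂ := realCoords (Complex.I • ζ)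

@[simp] lemma coords_inl (ζ : Cn n) (j : Fin n) : coords ζ (.inl j) = -((ζ j).im : ℂ) := by
  simp [coords, realCoords]

@[simp] lemma coords_inr (ζ : Cn n) (j : Fin n) : coords ζ (.inr j) = ((ζ j).re : ℂ) := by
  simp [coords, realCoords]

lemma coords_smul (r : ℝ) (ζ : Cn n) : coords (r • ζ) = (r : ℂ) • coords ζ := by
  ext (j | j) <;> simp

lemma realCoords_smul (r : ℝ) (ζ : Cn n) : realCoords (r • ζ) = (r : ℂ) • realCoords ζ := by
  ext (j | j) <;> simp [realCoords]

lemma continuous_coords : Continuous (coords : Cn n → _) := by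
  refine continuous_pi fun i => ?_
  rcases i with j | j <;> simp only [coords_inl, coords_inr] <;> fun_prop

lemma continuous_eval_coords (p : MvPolynomial (Fin n ⊕ Fin n) ℂ) :
    Continuous fun ζ : Cn n => eval (coords ζ) p :=
  (MvPolynomial.continuous_eval p).comp continuous_coords

lemma norm_coords_le (ζ : Cn n) (i : Fin n ⊕ Fin n) : ‖coords ζ i‖ ≤ ‖ζ‖ := by
  rcases i with j | j
  · simpa using (Complex.abs_im_le_norm _).trans (PiLp.norm_apply_le ζ j)
  · simpa using (Complex.abs_re_le_norm _).trans (PiLp.norm_apply_le ζ j)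

lemma sum_coords_sq (ζ : Cn n) : ∑ i, coords ζ i ^ 2 = ((‖ζ‖ ^ 2 : ℝ) : ℂ) := by
  rw [EuclideanSpace.norm_sq_eq, Fintype.sum_sum_type, ← Finset.sum_add_distrib]
  push_cast
  refine Finset.sum_congr rfl fun j _ => ?_
  rw [← Complex.ofReal_pow, Complex.sq_norm, Complex.normSq_apply]
  simp only [coords_inl, coords_inr]
  push_cast
  ring

lemma im_sum_mul_conj (z ζ : Cn n) :
    ((∑ j, z j * (starRingEnd ℂ) (ζ j)).im : ℂ) = eval (coords ζ) (linForm (realCoords z)) := by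
  rw [eval_linForm, Fintype.sum_sum_type, ← Finset.sum_add_distrib, Complex.im_sum]
  push_cast
  refine Finset.sum_congr rfl fun j _ => ?_
  simp [realCoords]

/-- The direction of the `i`-th symplectic coordinate. -/
def coordDir (i : Fin n ⊕ Fin n) : Cn n :=
  i.elim (fun j => EuclideanSpace.single j (-Complex.I)) (fun j => EuclideanSpace.single j 1)

lemma coords_add_smul_coordDir (ζ : Cn n) (i : Fin n ⊕ Fin n) (t : ℝ) (j : Fin n ⊕ Fin n) :
    coords (ζ + t • coordDir i) j = coords ζ j + t * (Pi.single i 1 : _ → ℂ) j := by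
  rcases i with i | i <;> rcases j with j | j <;> by_cases h : j = i <;>
    simp [coordDir, h, add_comm]

lemma hasLineDerivAt_eval_coords (p : MvPolynomial (Fin n ⊕ Fin n) ℂ) (ζ : Cn n)
    (i : Fin n ⊕ Fin n) :
    HasLineDerivAt ℝ (fun ζ => eval (coords ζ) p) (eval (coords ζ) (pderiv i p)) ζ
      (coordDir i) := by
  rw [HasLineDerivAt]
  induction p using MvPolynomial.induction_on with
  | C a => simpa using hasDerivAt_const (0 : ℝ) a
  | add p q hp hq =>
    simp only [map_add]
    exact hp.add hq
  | mul_X p j hp =>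
    have hX : HasDerivAt (fun t : ℝ => coords (ζ + t • coordDir i) j)
        ((Pi.single i 1 : _ → ℂ) j) 0 := by
      simp only [coords_add_smul_coordDir]
      simpa using (((hasDerivAt_id (0 : ℝ)).ofReal_comp).mul_const
        ((Pi.single i 1 : _ → ℂ) j)).const_add (coords ζ j)
    have h := hp.mul hX
    simp only [map_mul, eval_X]
    refine HasDerivAt.congr_deriv h ?_
    rw [pderiv_mul]
    rcases eq_or_ne j i with rfl | hij
    · simp
    · simp [hij]

lemma eval_smul_of_isHomogeneous {σ : Type*} {p : MvPolynomial σ ℂ} {m : ℕ}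
    (hp : p.IsHomogeneous m) (r : ℂ) (v : σ → ℂ) : eval (r • v) p = r ^ m * eval v p := by
  rw [eval_eq, eval_eq, Finset.mul_sum]
  refine Finset.sum_congr rfl fun d hd => ?_
  have : ∑ i ∈ d.support, d i = m := by
    rw [← hp (mem_support_iff.1 hd), Finsupp.weight_apply, Finsupp.sum]
    simp
  simp only [Pi.smul_apply, smul_eq_mul, mul_pow, Finset.prod_mul_distrib, Finset.prod_pow_eq_pow_sum,
    this]
  ring

/-- Integration of polynomials in the symplectic coordinates against the density `f`. -/
def polyIntegral (μ : Measure (Cn n)) (f : Cn n → ℂ)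
    (h : ∀ p, Integrable (fun ζ => eval (coords ζ) p * f ζ) μ) :
    MvPolynomial (Fin n ⊕ Fin n) ℂ →ₗ[ℂ] ℂ where
  toFun p := ∫ ζ, eval (coords ζ) p * f ζ ∂μ
  map_add' p q := by
    rw [← integral_add (h p) (h q)]
    simp [add_mul]
  map_smul' c p := by
    rw [RingHom.id_apply, smul_eq_mul, ← integral_const_mul]
    simp [mul_assoc, smul_eq_C_mul]

end Coords

/-! ### Gaussian integrals -/

section Gaussian

variable {n : ℕ}

/-- The Gaussian `exp (-‖ζ‖² / 2)`. -/
def gaussian (ζ : Cn n) : ℂ := Real.exp (-(1 / 2) * ‖ζ‖ ^ 2)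

lemma gaussian_eq (ζ : Cn n) :
    gaussian ζ = Complex.exp (eval (coords ζ) (C (-(1 / 2)) * ∑ i, X i ^ 2)) := by
  rw [gaussian, Complex.ofReal_exp]
  simp only [map_mul, eval_C, map_sum, map_pow, eval_X, sum_coords_sq]
  push_cast
  rfl

lemma continuous_gaussian : Continuous (gaussian : Cn n → ℂ) := by
  unfold gaussian
  fun_prop

lemma integrable_norm_pow_mul_exp [NeZero n] (k : ℕ) :
    Integrable fun ζ : Cn n => ‖ζ‖ ^ k * Real.exp (-(1 / 2) * ‖ζ‖ ^ 2) := by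
  rw [integrable_fun_norm_addHaar volume (f := fun r => r ^ k * Real.exp (-(1 / 2) * r ^ 2))]
  have := integrableOn_rpow_mul_exp_neg_mul_sq (b := 1 / 2) (by norm_num)
    (s := ((Module.finrank ℝ (Cn n) - 1 + k : ℕ) : ℝ)) (by
      have := Nat.cast_nonneg (α := ℝ) (Module.finrank ℝ (Cn n) - 1 + k); linarith)
  simpa only [Real.rpow_natCast, pow_add, smul_eq_mul, mul_assoc] using this

lemma integrable_eval_mul_gaussian [NeZero n] (p : MvPolynomial (Fin n ⊕ Fin n) ℂ) :
    Integrable fun ζ : Cn n => eval (coords ζ) p * gaussian ζ := by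
  induction p using MvPolynomial.induction_on' with
  | add p q hp hq =>
    simp only [map_add, add_mul]
    exact hp.add hq
  | monomial m a =>
    refine ((integrable_norm_pow_mul_exp (n := n) (∑ i, m i)).const_mul ‖a‖).mono'
      ((continuous_eval_coords _).mul continuous_gaussian).aestronglyMeasurable
      (Filter.Eventually.of_forall fun ζ => ?_)
    rw [eval_monomial, Finsupp.prod_fintype _ _ (by simp), norm_mul, norm_mul, norm_prod,
      ← Finset.prod_pow_eq_pow_sum, gaussian, Complex.norm_real, Real.norm_eq_abs, Real.abs_exp,
      mul_assoc]
    gcongr with i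
    rw [norm_pow]
    gcongr
    exact norm_coords_le ζ i

/-- The Gaussian integral of a polynomial. -/
def gaussianIntegral (n : ℕ) [NeZero n] : MvPolynomial (Fin n ⊕ Fin n) ℂ →ₗ[ℂ] ℂ :=
  polyIntegral volume gaussian integrable_eval_mul_gaussian

lemma hasLineDerivAt_gaussian (ζ : Cn n) (i : Fin n ⊕ Fin n) :
    HasLineDerivAt ℝ gaussian (-(coords ζ i * gaussian ζ)) ζ (coordDir i) := by
  have h := hasLineDerivAt_eval_coords (C (-(1 / 2)) * ∑ i, X i ^ 2) ζ i
  rw [HasLineDerivAt] at h ⊢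
  simp only [gaussian_eq]
  refine h.cexp.congr_deriv ?_
  have : pderiv i (C (-(1 / 2)) * ∑ i, X i ^ 2 : MvPolynomial (Fin n ⊕ Fin n) ℂ) = -X i := by
    rw [pderiv_C_mul, map_sum, Finset.sum_eq_single i]
    · rw [pderiv_pow, pderiv_X_self, mul_one, ← mul_assoc, ← map_natCast C 2, ← map_mul]
      simp
    · intro j _ hj
      rw [pderiv_pow, pderiv_X_of_ne hj, mul_zero]
    · simp
  rw [this]
  simp
  ring

/-- Stein's identity: Gaussian integration by parts. -/
lemma gaussianIntegral_X_mul [NeZero n] (i : Fin n ⊕ Fin n)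
    (p : MvPolynomial (Fin n ⊕ Fin n) ℂ) :
    gaussianIntegral n (X i * p) = gaussianIntegral n (pderiv i p) := by
  have h := integral_bilinear_hasLineDerivAt_right_eq_neg_left_of_integrable
    (μ := (volume : Measure (Cn n))) (f := fun ζ => eval (coords ζ) p)
    (f' := fun ζ => eval (coords ζ) (pderiv i p)) (g := gaussian)
    (g' := fun ζ => -(coords ζ i * gaussian ζ)) (v := coordDir i)
    (B := ContinuousLinearMap.mul ℝ ℂ)
    (integrable_eval_mul_gaussian _)
    (by
      refine (integrable_eval_mul_gaussian (X i * p)).neg.congr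
        (Filter.Eventually.of_forall fun ζ => ?_)
      simp
      ring)
    (integrable_eval_mul_gaussian _)
    (fun ζ _ => hasLineDerivAt_eval_coords p ζ i) (fun ζ _ => hasLineDerivAt_gaussian ζ i)
  simp only [ContinuousLinearMap.mul_apply', mul_neg, integral_neg, neg_inj] at h
  refine Eq.trans (integral_congr_ae (Filter.Eventually.of_forall fun ζ => ?_)) h
  simp only [map_mul, eval_X]
  ring

end Gaussian

/-! ### Surface measure -/

section Surface

variable {n : ℕ}

instance : IsFiniteMeasure (surfaceMeasure n) := by
  unfold surfaceMeasure
  infer_instance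

lemma ae_norm_eq_one : ∀ᵐ ζ ∂surfaceMeasure n, ‖ζ‖ = 1 := by
  rw [surfaceMeasure, ae_map_iff measurable_subtype_coe.aemeasurable
    (measurableSet_eq_fun measurable_norm measurable_const)]
  exact Filter.Eventually.of_forall fun ζ => norm_eq_of_mem_sphere ζ

lemma integral_surfaceMeasure (f : Cn n → ℂ) :
    ∫ ζ, f ζ ∂surfaceMeasure n = ∫ ζ, f (Subtype.val ζ) ∂(volume : Measure (Cn n)).toSphere :=
  (MeasurableEmbedding.subtype_coe Metric.isClosed_sphere.measurableSet).integral_map f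

lemma exists_ae_norm_eval_le (p : MvPolynomial (Fin n ⊕ Fin n) ℂ) :
    ∃ M : ℝ, ∀ᵐ ζ ∂surfaceMeasure n, ‖eval (coords ζ) p‖ ≤ M := by
  obtain ⟨M, hM⟩ := (isCompact_sphere (0 : Cn n) 1).exists_bound_of_continuousOn
    (continuous_eval_coords p).continuousOn
  exact ⟨M, ae_norm_eq_one.mono fun ζ hζ => hM ζ (by simpa using hζ)⟩

lemma integrable_eval_mul {f : Cn n → ℂ} (hf : Integrable f (surfaceMeasure n))
    (p : MvPolynomial (Fin n ⊕ Fin n) ℂ) :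
    Integrable (fun ζ => eval (coords ζ) p * f ζ) (surfaceMeasure n) := by
  obtain ⟨M, hM⟩ := exists_ae_norm_eval_le p
  exact hf.bdd_mul (continuous_eval_coords p).aestronglyMeasurable hM

/-- Integration of polynomials over the sphere against an integrable density. -/
def sphereIntegral {f : Cn n → ℂ} (hf : Integrable f (surfaceMeasure n)) :
    MvPolynomial (Fin n ⊕ Fin n) ℂ →ₗ[ℂ] ℂ :=
  polyIntegral (surfaceMeasure n) f (integrable_eval_mul hf)

lemma sphereIntegral_sum_sq_mul {f : Cn n → ℂ} (hf : Integrable f (surfaceMeasure n))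
    (p : MvPolynomial (Fin n ⊕ Fin n) ℂ) :
    sphereIntegral hf ((∑ i, X i ^ 2) * p) = sphereIntegral hf p := by
  refine integral_congr_ae (ae_norm_eq_one.mono fun ζ hζ => ?_)
  simp only [map_mul, map_sum, map_pow, eval_X, sum_coords_sq, hζ]
  simp

/-- Polar coordinates for homogeneous polynomials. -/
lemma exists_gaussianIntegral_eq [NeZero n] (m : ℕ) :
    ∃ c : ℂ, c ≠ 0 ∧ ∀ p : MvPolynomial (Fin n ⊕ Fin n) ℂ, p.IsHomogeneous m →
      gaussianIntegral n p = (∫ ζ, eval (coords ζ) p ∂surfaceMeasure n) * c := by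
  set ν := Measure.volumeIoiPow (Module.finrank ℝ (Cn n) - 1)
  set g : Set.Ioi (0 : ℝ) → ℂ := fun r => (r.1 : ℂ) ^ m * Real.exp (-(1 / 2) * r.1 ^ 2)
  -- Stated beyond polynomials so that `φ = ‖ζ‖ ^ m`, whose Gaussian integral is positive, shows
  -- that the radial constant is nonzero.
  have key (φ : Cn n → ℂ) (hφ : ∀ (r : ℝ) ζ, 0 < r → φ (r • ζ) = (r : ℂ) ^ m * φ ζ) :
      ∫ ζ, φ ζ * gaussian ζ = (∫ ζ, φ ζ ∂surfaceMeasure n) * ∫ r, g r ∂ν := by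
    have hmul := integral_prod_mul (μ := (volume : Measure (Cn n)).toSphere) (ν := ν)
      (fun ζ => φ ζ.1) g
    have hpol := (Measure.measurePreserving_homeomorphUnitSphereProd
      (volume : Measure (Cn n))).integral_comp (Homeomorph.measurableEmbedding _)
      (fun x => φ x.1.1 * g x.2)
    have hsub := integral_subtype_comap (μ := (volume : Measure (Cn n)))
      (measurableSet_singleton 0).compl fun ζ => φ ζ * gaussian ζ
    rw [restrict_compl_singleton] at hsub
    rw [integral_surfaceMeasure, ← hmul, ← hpol, ← hsub]
    · refine integral_congr_ae (Filter.Eventually.of_forall fun ζ => ?_)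
      have hpos : 0 < ‖ζ.1‖ := norm_pos_iff.2 ζ.2
      have hζ : ζ.1 = ‖ζ.1‖ • (homeomorphUnitSphereProd (Cn n) ζ).1.1 := by
        simp [smul_smul, hpos.ne']
      simp only [g, homeomorphUnitSphereProd_apply_snd_coe]
      conv_lhs => rw [show φ ζ.1 = _ from (congrArg φ hζ).trans (hφ _ _ hpos)]
      rw [gaussian]
      ring
  refine ⟨∫ r, g r ∂ν, fun h0 => ?_, fun p hp => key _ fun r ζ _ => ?_⟩
  · have h := key (fun ζ => ((‖ζ‖ ^ m : ℝ) : ℂ)) fun r ζ hr => by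
      rw [norm_smul, Real.norm_of_nonneg hr.le, mul_pow]
      push_cast
      rfl
    rw [h0, mul_zero] at h
    simp only [gaussian, ← Complex.ofReal_mul, integral_complex_ofReal, Complex.ofReal_eq_zero] at h
    refine h.not_gt ((integral_pos_iff_support_of_nonneg (fun ζ => by positivity)
      (integrable_norm_pow_mul_exp m)).2 ?_)
    refine lt_of_lt_of_le (isOpen_compl_singleton.measure_pos volume
      (Set.nonempty_compl_of_nontrivial (0 : Cn n))) (measure_mono fun ζ hζ => ?_)
    have : 0 < ‖ζ‖ := norm_pos_iff.2 hζ
    exact (by positivity : 0 < ‖ζ‖ ^ m * Real.exp (-(1 / 2) * ‖ζ‖ ^ 2)).ne'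
  · rw [coords_smul, eval_smul_of_isHomogeneous hp]

/-- The moments along `w` of a harmonic homogeneous density vanishing at `w` are zero. -/
lemma integral_linForm_pow_mul_eq_zero [NeZero n] {P : MvPolynomial (Fin n ⊕ Fin n) ℂ} {l : ℕ}
    (hl : P.IsHomogeneous l) (hP : laplacian P = 0) {w : Fin n ⊕ Fin n → ℂ} (hw : eval w P = 0)
    (k : ℕ) : ∫ ζ, eval (coords ζ) (linForm w ^ k * P) ∂surfaceMeasure n = 0 := by
  obtain ⟨c, hc, h⟩ := exists_gaussianIntegral_eq (n := n) (1 * k + l)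
  have h1 := h _ (((isHomogeneous_linForm w).pow k).mul hl)
  rw [map_linForm_pow_mul_eq_zero _ gaussianIntegral_X_mul w k l P hl hP hw] at h1
  exact (mul_eq_zero.1 h1.symm).resolve_right hc

/-- Power series expansion of the symplectic Fourier transform. -/
lemma hasSum_integral_exp_mul {f : Cn n → ℂ} (hf : Integrable f (surfaceMeasure n))
    (c : ℂ) (p : MvPolynomial (Fin n ⊕ Fin n) ℂ) :
    HasSum (fun k : ℕ => c ^ k / k.factorial * sphereIntegral hf (p ^ k))
      (∫ ζ, Complex.exp (c * eval (coords ζ) p) * f ζ ∂surfaceMeasure n) := by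
  obtain ⟨M, hM⟩ := exists_ae_norm_eval_le p
  have hF (k : ℕ) : Integrable
      (fun ζ => c ^ k / k.factorial * (eval (coords ζ) (p ^ k) * f ζ)) (surfaceMeasure n) :=
    (integrable_eval_mul hf _).const_mul _
  have h := hasSum_integral_of_summable_integral_norm hF (by
    have hM0 : 0 ≤ max M 0 := le_max_right _ _
    refine Summable.of_nonneg_of_le (fun k => by positivity) (fun k => ?_)
      ((Real.summable_pow_div_factorial (‖c‖ * max M 0)).mul_right
        (∫ ζ, ‖f ζ‖ ∂surfaceMeasure n))
    rw [← integral_const_mul]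
    refine integral_mono_ae (hF k).norm (hf.norm.const_mul _) (hM.mono fun ζ hζ => ?_)
    simp only [norm_mul, norm_div, norm_pow, map_pow, Complex.norm_natCast, mul_pow]
    rw [← mul_assoc, div_mul_eq_mul_div]
    gcongr
    exact hζ.trans (le_max_left _ _))
  have hterm : (fun k : ℕ => c ^ k / k.factorial * sphereIntegral hf (p ^ k)) = fun k =>
      ∫ ζ, c ^ k / k.factorial * (eval (coords ζ) (p ^ k) * f ζ) ∂surfaceMeasure n := by
    ext k
    rw [integral_const_mul]
    rfl
  have hsum : (fun ζ => Complex.exp (c * eval (coords ζ) p) * f ζ) = fun ζ =>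
      ∑' k : ℕ, c ^ k / k.factorial * (eval (coords ζ) (p ^ k) * f ζ) := by
    ext ζ
    rw [Complex.exp_eq_exp_ℂ, NormedSpace.exp_eq_tsum_div, ← tsum_mul_right]
    refine tsum_congr fun k => ?_
    rw [mul_pow, map_pow]
    ring
  rw [hterm, hsum]
  exact h

end Surface

end SymplecticHUP

end

noncomputable section

namespace SymplecticHUP

open MvPolynomial

variable {n : ℕ}

/-! ### Uniqueness for the Fourier transform of integrable densities -/

/-- The positive and negative parts of `g` are densities of finite measures with equal
characteristic functions, so they agree almost everywhere. -/
lemma ae_eq_zero_of_integral_exp_inner_real {E : Type*} [NormedAddCommGroup E]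
    [InnerProductSpace ℝ E] [CompleteSpace E] [SecondCountableTopology E] [MeasurableSpace E]
    [BorelSpace E] {μ : Measure E} {g : E → ℝ} (hg : Integrable g μ)
    (h : ∀ t, ∫ x, Complex.exp (inner ℝ x t * Complex.I) * (g x : ℂ) ∂μ = 0) : g =ᵐ[μ] 0 := by
  have hfin (g : E → ℝ) (hg : Integrable g μ) :
      IsFiniteMeasure (μ.withDensity fun x => ENNReal.ofReal (g x)) :=
    isFiniteMeasure_withDensity_ofReal hg.2
  have := hfin g hg
  have := hfin (fun x => -g x) hg.neg
  have hchar (g : E → ℝ) (hg : Integrable g μ) (t : E) :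
      charFun (μ.withDensity fun x => ENNReal.ofReal (g x)) t =
        ∫ x, Complex.exp (inner ℝ x t * Complex.I) * ((max (g x) 0 : ℝ) : ℂ) ∂μ := by
    rw [charFun_apply, integral_withDensity_eq_integral_toReal_smul₀ hg.1.aemeasurable.ennreal_ofReal
      (Filter.Eventually.of_forall fun _ => ENNReal.ofReal_lt_top)]
    refine integral_congr_ae (Filter.Eventually.of_forall fun x => ?_)
    simp only [Complex.real_smul, ENNReal.toReal_ofReal']
    ring
  have hint (g : E → ℝ) (hg : Integrable g μ) (t : E) : Integrable
      (fun x => Complex.exp (inner ℝ x t * Complex.I) * ((max (g x) 0 : ℝ) : ℂ)) μ := by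
    refine hg.pos_part.ofReal.bdd_mul (c := 1) ?_ (Filter.Eventually.of_forall fun x => ?_)
    · exact (by fun_prop : Continuous fun x : E =>
        Complex.exp (inner ℝ x t * Complex.I)).aestronglyMeasurable
    · rw [Complex.norm_exp_ofReal_mul_I]
  have heq : (μ.withDensity fun x => ENNReal.ofReal (g x)) =
      μ.withDensity fun x => ENNReal.ofReal (-g x) := by
    refine Measure.ext_of_charFun (funext fun t => ?_)
    rw [hchar g hg, hchar (fun x => -g x) hg.neg, ← sub_eq_zero,
      ← integral_sub (hint g hg t) (hint (fun x => -g x) hg.neg t), ← h t]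
    refine integral_congr_ae (Filter.Eventually.of_forall fun x => ?_)
    simp only
    rw [← mul_sub, ← Complex.ofReal_sub]
    congr 2
    rcases le_total (g x) 0 with hx | hx <;> simp [hx]
  have hae := (withDensity_eq_iff hg.1.aemeasurable.ennreal_ofReal
    hg.neg.1.aemeasurable.ennreal_ofReal
    (by rw [← setLIntegral_univ, ← withDensity_apply _ MeasurableSet.univ]
        exact measure_ne_top _ _)).1 heq
  filter_upwards [hae] with x hx
  have h1 := congrArg ENNReal.toReal hx
  simp only [ENNReal.toReal_ofReal'] at h1
  rcases le_total (g x) 0 with h2 | h2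
  · simpa [h2, eq_comm] using h1
  · simpa [h2] using h1

lemma ae_eq_zero_of_integral_exp_inner {E : Type*} [NormedAddCommGroup E]
    [InnerProductSpace ℝ E] [CompleteSpace E] [SecondCountableTopology E] [MeasurableSpace E]
    [BorelSpace E] {μ : Measure E} {f : E → ℂ} (hf : Integrable f μ)
    (h : ∀ t, ∫ x, Complex.exp (inner ℝ x t * Complex.I) * f x ∂μ = 0) : f =ᵐ[μ] 0 := by
  have hint (f : E → ℂ) (hf : Integrable f μ) (t : E) :
      Integrable (fun x => Complex.exp (inner ℝ x t * Complex.I) * f x) μ := by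
    refine hf.bdd_mul (c := 1) ?_ (Filter.Eventually.of_forall fun x => ?_)
    · exact (by fun_prop : Continuous fun x : E =>
        Complex.exp (inner ℝ x t * Complex.I)).aestronglyMeasurable
    · rw [Complex.norm_exp_ofReal_mul_I]
  have hfc : Integrable (fun x => (starRingEnd ℂ) (f x)) μ :=
    (Complex.conjLIE.integrable_comp_iff).2 hf
  -- Conjugating the hypothesis at `-t` gives it for the conjugate of `f`, which separates real and
  -- imaginary parts.
  have hconj (t : E) :
      ∫ x, Complex.exp (inner ℝ x t * Complex.I) * (starRingEnd ℂ) (f x) ∂μ = 0 := by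
    have := congrArg (starRingEnd ℂ) (h (-t))
    rw [← integral_conj, map_zero] at this
    rw [← this]
    refine integral_congr_ae (Filter.Eventually.of_forall fun x => ?_)
    simp [← Complex.exp_conj, inner_neg_right]
  have hre : (fun x => (f x).re) =ᵐ[μ] 0 := by
    refine ae_eq_zero_of_integral_exp_inner_real hf.re fun t => ?_
    have := integral_add (hint f hf t) (hint _ hfc t)
    rw [h, hconj, add_zero] at this
    rw [← mul_right_inj' (two_ne_zero (α := ℂ)), mul_zero, ← this, ← integral_const_mul]
    refine integral_congr_ae (Filter.Eventually.of_forall fun x => ?_)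
    simp only
    rw [← mul_add, Complex.add_conj]
    push_cast
    ring
  have him : (fun x => (f x).im) =ᵐ[μ] 0 := by
    refine ae_eq_zero_of_integral_exp_inner_real hf.im fun t => ?_
    have := integral_sub (hint f hf t) (hint _ hfc t)
    rw [h, hconj, sub_zero] at this
    rw [← mul_right_inj' (mul_ne_zero (two_ne_zero (α := ℂ)) Complex.I_ne_zero), mul_zero, ← this,
      ← integral_const_mul]
    refine integral_congr_ae (Filter.Eventually.of_forall fun x => ?_)
    simp only
    rw [← mul_sub, Complex.sub_conj]
    push_cast
    ring
  filter_upwards [hre, him] with x h1 h2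
  exact Complex.ext h1 h2

/-- The phase of the symplectic Fourier transform at `-2i t` is the real inner product with `t`. -/
lemma neg_half_mul_im_eq_inner (t ζ : Cn n) :
    -(Complex.I / 2) *
        ((∑ j, ((-2 * Complex.I) • t) j * (starRingEnd ℂ) (ζ j)).im : ℂ) =
      inner ℝ ζ t * Complex.I := by
  have : (∑ j, ((-2 * Complex.I) • t) j * (starRingEnd ℂ) (ζ j)).im = -2 * inner ℝ ζ t := by
    simp only [PiLp.inner_apply, Complex.inner, Complex.im_sum, Finset.mul_sum]
    refine Finset.sum_congr rfl fun j _ => ?_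
    simp
    ring
  rw [this]
  push_cast
  ring

/-! ### Densities of complex measures -/

lemma withDensityᵥ_rnDeriv_eq {α : Type*} [MeasurableSpace α] {ν : Measure α} [SigmaFinite ν]
    {μ : ComplexMeasure α} (h : μ ≪ᵥ ν.toENNRealVectorMeasure) :
    ν.withDensityᵥ (μ.rnDeriv ν) = μ := by
  rw [ComplexMeasure.absolutelyContinuous_ennreal_iff] at h
  have hre := SignedMeasure.withDensityᵥ_rnDeriv_eq _ ν h.1
  have him := SignedMeasure.withDensityᵥ_rnDeriv_eq _ ν h.2
  have hint := μ.integrable_rnDeriv ν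
  ext s hs : 1
  rw [withDensityᵥ_apply hint hs]
  apply Complex.ext
  · rw [← RCLike.re_eq_complex_re, ← integral_re hint.integrableOn]
    refine Eq.trans ?_ (congrArg (fun v : SignedMeasure α => v s) hre)
    exact (withDensityᵥ_apply (SignedMeasure.integrable_rnDeriv _ _) hs).symm
  · rw [← RCLike.im_eq_complex_im, ← integral_im hint.integrableOn]
    refine Eq.trans ?_ (congrArg (fun v : SignedMeasure α => v s) him)
    exact (withDensityᵥ_apply (SignedMeasure.integrable_rnDeriv _ _) hs).symm

lemma withDensityᵥ_absolutelyContinuous {α : Type*} [MeasurableSpace α] {ν : Measure α}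
    {f : α → ℂ} (hf : Integrable f ν) : ν.withDensityᵥ f ≪ᵥ ν.toENNRealVectorMeasure := by
  refine VectorMeasure.AbsolutelyContinuous.mk fun s hs h0 => ?_
  rw [Measure.toENNRealVectorMeasure_apply_measurable hs] at h0
  rw [withDensityᵥ_apply hf hs, Measure.restrict_zero_set h0, integral_zero_measure]

lemma withDensityᵥ_mem_sphereMeasures {f : Cn n → ℂ} (hf : Integrable f (surfaceMeasure n)) :
    (surfaceMeasure n).withDensityᵥ f ∈ sphereMeasures n := by
  refine ⟨fun A hA => ?_, withDensityᵥ_absolutelyContinuous hf⟩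
  by_cases hm : MeasurableSet A
  · rw [withDensityᵥ_apply hf hm, Measure.restrict_zero_set, integral_zero_measure]
    refine measure_mono_null (fun ζ hζ => ?_) ae_norm_eq_one
    exact fun h => Set.disjoint_left.1 hA hζ (by simpa using h)
  · exact VectorMeasure.not_measurable _ hm

lemma rnDeriv_withDensityᵥ {f : Cn n → ℂ} (hf : Integrable f (surfaceMeasure n)) :
    ComplexMeasure.rnDeriv ((surfaceMeasure n).withDensityᵥ f) (surfaceMeasure n)
      =ᵐ[surfaceMeasure n] f :=
  (ComplexMeasure.integrable_rnDeriv _ _).ae_eq_of_withDensityᵥ_eq hf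
    (withDensityᵥ_rnDeriv_eq (withDensityᵥ_absolutelyContinuous hf))

lemma symplecticFourier_eq (μ : ComplexMeasure (Cn n)) (z : Cn n) :
    symplecticFourier μ z = ∫ ζ, Complex.exp (-(Complex.I / 2) *
      eval (coords ζ) (linForm (realCoords z))) * μ.rnDeriv (surfaceMeasure n) ζ
        ∂surfaceMeasure n := by
  simp only [symplecticFourier, im_sum_mul_conj]

lemma hasSum_symplecticFourier (μ : ComplexMeasure (Cn n)) (z : Cn n) :
    HasSum (fun k : ℕ => (-(Complex.I / 2)) ^ k / k.factorial *
      sphereIntegral (μ.integrable_rnDeriv (surfaceMeasure n)) (linForm (realCoords z) ^ k))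
      (symplecticFourier μ z) := by
  rw [symplecticFourier_eq]
  exact hasSum_integral_exp_mul _ _ _

lemma eq_zero_of_symplecticFourier_eq_zero {μ : ComplexMeasure (Cn n)}
    (hμ : μ ∈ sphereMeasures n) (h : ∀ z, symplecticFourier μ z = 0) : μ = 0 := by
  have hf := μ.integrable_rnDeriv (surfaceMeasure n)
  have h0 : μ.rnDeriv (surfaceMeasure n) =ᵐ[surfaceMeasure n] 0 := by
    refine ae_eq_zero_of_integral_exp_inner hf fun t => ?_
    rw [← h ((-2 * Complex.I) • t), symplecticFourier]
    simp only [neg_half_mul_im_eq_inner]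
  rw [← withDensityᵥ_rnDeriv_eq hμ.2, WithDensityᵥEq.congr_ae h0, withDensityᵥ_zero]

/-! ### Polynomials vanishing on the sphere -/

/-- `coords` hits every real point, and a product of infinite sets determines a polynomial. -/
lemma eq_zero_of_forall_eval_coords_eq_zero {P : MvPolynomial (Fin n ⊕ Fin n) ℂ}
    (h : ∀ ζ : Cn n, eval (coords ζ) P = 0) : P = 0 := by
  refine funext_set (fun _ => Set.range ((↑) : ℝ → ℂ))
    (fun _ => Set.infinite_range_of_injective Complex.ofReal_injective) fun x hx => ?_
  choose r hr using fun i => hx i (Set.mem_univ i)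
  have : x = coords (WithLp.toLp 2 fun j => (⟨r (.inr j), -r (.inl j)⟩ : ℂ) : Cn n) := by
    ext (j | j) <;> simp [← hr]
  rw [this, h, map_zero]

/-- Continuity upgrades almost everywhere to everywhere on the sphere, homogeneity extends this to
nonzero vectors, and density covers the origin. -/
lemma eq_zero_of_ae_eval_coords_eq_zero [NeZero n] {P : MvPolynomial (Fin n ⊕ Fin n) ℂ} {l : ℕ}
    (hl : P.IsHomogeneous l)
    (h : (fun ζ => eval (coords ζ) P) =ᵐ[surfaceMeasure n] 0) : P = 0 := by
  have hS : (fun ζ : Metric.sphere (0 : Cn n) 1 => eval (coords ζ.1) P) = fun _ => 0 := by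
    refine Continuous.ae_eq_iff_eq (volume : Measure (Cn n)).toSphere
      ((continuous_eval_coords P).comp continuous_subtype_val) continuous_const |>.1 ?_
    exact ae_of_ae_map measurable_subtype_coe.aemeasurable h
  have hne (ζ : Cn n) (hζ : ζ ≠ 0) : eval (coords ζ) P = 0 := by
    have h1 : ζ = ‖ζ‖ • (‖ζ‖⁻¹ • ζ) := by simp [smul_smul, hζ]
    have h2 := congrFun hS ⟨‖ζ‖⁻¹ • ζ, by simp [norm_smul, hζ]⟩
    rw [h1, coords_smul, eval_smul_of_isHomogeneous hl]
    simp only at h2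
    rw [h2, mul_zero]
  refine eq_zero_of_forall_eval_coords_eq_zero fun ζ => ?_
  exact congrFun (Continuous.ext_on (dense_compl_singleton (0 : Cn n)) (continuous_eval_coords P)
    continuous_const fun ζ hζ => hne ζ hζ) ζ

/-! ### The two implications -/

lemma eq_zero_of_hasSum_pow_mul {a : ℕ → ℂ} (h : ∀ t : ℝ, HasSum (fun k => (t : ℂ) ^ k * a k) 0)
    (k : ℕ) : a k = 0 := by
  let p : FormalMultilinearSeries ℝ ℝ ℂ := fun k => ContinuousMultilinearMap.mkPiRing ℝ (Fin k) (a k)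
  have hs : Summable fun k => ‖a k‖ := by simpa using (h 1).summable.norm
  -- Summability at `t = 1` gives radius at least 1; uniqueness of the power series of the zero
  -- function finishes.
  have hp : HasFPowerSeriesAt (0 : ℝ → ℂ) p 0 := by
    refine ⟨1, ⟨?_, one_pos, fun {y} _ => ?_⟩⟩
    · exact_mod_cast p.le_radius_of_summable_norm (r := 1) (by simpa [p] using hs)
    · simpa [p] using h y
  have := congrArg (fun q : FormalMultilinearSeries ℝ ℝ ℂ => q k 1) hp.eq_zero
  simpa [p] using this

lemma linForm_smul {σ : Type*} [Fintype σ] (c : ℂ) (w : σ → ℂ) :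
    linForm (c • w) = c • linForm w := by
  simp [linForm, Finset.smul_sum, smul_eq_C_mul, mul_assoc]

theorem isNonHarmonic_of_isHeisenbergUniquenessPair [NeZero n] {C : Set (Cn n)}
    (h : IsHeisenbergUniquenessPair C) : IsNonHarmonic C := by
  rintro ⟨l, P, hP0, hl, hP, hC⟩
  have hf : Integrable (fun ζ => eval (coords ζ) P) (surfaceMeasure n) := by
    simpa using integrable_eval_mul (integrable_const (1 : ℂ)) P
  have hrn := rnDeriv_withDensityᵥ hf
  have hzero := h _ (withDensityᵥ_mem_sphereMeasures hf) fun z hz => by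
    refine (hasSum_symplecticFourier _ z).unique ?_
    convert hasSum_zero with k
    refine mul_eq_zero_of_right _ ?_
    rw [← integral_linForm_pow_mul_eq_zero hl hP (hC z hz) k]
    refine integral_congr_ae (hrn.mono fun ζ hζ => ?_)
    simp only [hζ, map_mul]
  refine hP0 (eq_zero_of_ae_eval_coords_eq_zero hl ?_)
  exact hf.ae_eq_of_withDensityᵥ_eq (integrable_zero _ _ _) (hzero.trans withDensityᵥ_zero.symm)

theorem isHeisenbergUniquenessPair_of_isNonHarmonic {C : Set (Cn n)} (hcone : IsRealCone C)
    (h : IsNonHarmonic C) : IsHeisenbergUniquenessPair C := by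
  intro μ hμ hF
  set T := sphereIntegral (μ.integrable_rnDeriv (surfaceMeasure n)) with hT
  have hmom (z : Cn n) (hz : z ∈ C) (k : ℕ) : T (linForm (realCoords z) ^ k) = 0 := by
    have := eq_zero_of_hasSum_pow_mul
      (a := fun k => (-(Complex.I / 2)) ^ k / k.factorial * T (linForm (realCoords z) ^ k))
      (fun t => ?_) k
    · exact (mul_eq_zero.1 this).resolve_left (by simp [Nat.factorial_ne_zero])
    -- The only use of the cone: `t • z` stays in `C`, so the expansion is a power series in `t`
    -- that sums to zero.
    · have hs := hasSum_symplecticFourier μ (t • z)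
      rw [hF _ (hcone t z hz)] at hs
      convert hs using 2 with k
      rw [realCoords_smul, linForm_smul, smul_pow, map_smul, smul_eq_mul]
      ring
  have hT0 : T = 0 := by
    by_contra hne
    obtain ⟨k, hk, hk'⟩ := exists_harmonic_momentPoly T (sphereIntegral_sum_sq_mul _) hne
    refine h ⟨k, momentPoly T k, hk, isHomogeneous_momentPoly T k, hk', fun z hz => ?_⟩
    have := eval_momentPoly T k (realCoords z)
    rw [hmom z hz] at this
    exact (mul_eq_zero.1 this).resolve_left (Nat.cast_ne_zero.2 (Nat.factorial_ne_zero k))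
  -- With `T = 0` the expansion vanishes at every `z`, not only on `C`.
  refine eq_zero_of_symplecticFourier_eq_zero hμ fun z => ?_
  refine (hasSum_symplecticFourier μ z).unique ?_
  rw [← hT, hT0]
  simp

lemma IsComplexCone.isRealCone {C : Set (Cn n)} (h : IsComplexCone C) : IsRealCone C :=
  fun c z hz => by simpa using h c z hz

end SymplecticHUP

end

theorem theorem3p1 (n : ℕ) (hn : 2 ≤ n) :
    (∀ C : Set (SymplecticHUP.Cn n), SymplecticHUP.IsComplexCone C →
      (SymplecticHUP.IsHeisenbergUniquenessPair C ↔ SymplecticHUP.IsNonHarmonic C)) ∧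
    (∀ C : Set (SymplecticHUP.Cn n), SymplecticHUP.IsRealCone C →
      (SymplecticHUP.IsHeisenbergUniquenessPair C ↔ SymplecticHUP.IsNonHarmonic C)) := by
  have : NeZero n := ⟨by omega⟩
  have hreal (C : Set (SymplecticHUP.Cn n)) (hC : SymplecticHUP.IsRealCone C) :
      SymplecticHUP.IsHeisenbergUniquenessPair C ↔ SymplecticHUP.IsNonHarmonic C :=
    ⟨SymplecticHUP.isNonHarmonic_of_isHeisenbergUniquenessPair,
      SymplecticHUP.isHeisenbergUniquenessPair_of_isNonHarmonic hC⟩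
  exact ⟨fun C hC => hreal C hC.isRealCone, hreal⟩
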